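/- Let $k\ge 2$ be an integer. For $m\ge 1$, an $m$-operation on $\{0,1\}$ of arity $n\ge 1$ is an $m$-tuple $\boldsymbol f=(\boldsymbol f^{(1)},\dots,\boldsymbol f^{(m)})$ of functions $\{0,1\}^n\to\{0,1\}$; an $m$-clone on $\{0,1\}$ is a set of $m$-operations that is closed under coordinatewise composition and contains, for all $1\le i\le n$, the $m$-tuple each of whose entries is the $n$-ary projection to the $i$-th variable. Let $\mathfrak L_m$ be the set of all $m$-clones on $\{0,1\}$ (equivalently, of all sets of $m$-operations that are closed with respect to the operator assigning to a set the smallest $m$-clone containing it). A $k$-sorted relation on $\{0,1\}$ is a relation of some arity $n\geq 0$ on $\{0,1\}$ each of whose $n$ variables has a sort in $\{1,\dots,k\}$ (written as a superscript). Let $CR^k_{1-6}$ be the set of all $k$-sorted relations without dummy variables that, up to an order of the variables, have one of the following forms, where addition is modulo $2$ and differently named variables are different: \begin{enumerate} \item $x^i=0\lor y^i=1$, for $1\le i\le k$; \item $x^i=y^i\lor u^j=b$, for $1\le i,j\le k$ and $b\in\{0,1\}$; \item $x^i=y^i\lor u^j=v^j$ for $1\le i,j\le k$, $i\ne j$, and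 $x^i=y^i\lor y^i=z^i$ for $1\le i\le k$; \item $x^i+y^i=1$, for $1\le i\le k$; \item $x^i+y^i=u^j+v^j$, for $1\le i,j\le k$; \item $x^{s_1}+x^{s_2}+\dots+x^{s_n}=b$, for $n\ge2$, pairwise distinct $s_1,\dots,s_n\in\{1,\dots,k\}$ and $b\in\{0,1\}$ (where $x^{s_1},\dots,x^{s_n}$ are $n$ different variables). \end{enumerate} Say that a poset $Q$ embeds into a poset $P$ if there is an injective order-preserving map $Q\to P$. Then the poset $(\mathfrak L_k,\subseteq)$ of all $k$-clones on $\{0,1\}$ embeds into the product poset $$(2^{CR^k_{1-6}},\supseteq)\times(\mathcal D(\mathbb N_0^{2k}),\supseteq)\times\prod_{i=1}^{2k}\Bigl((\mathfrak L_{k-1}\cup\{\emptyset\},\subseteq)\times(\{0,1\},\le)\Bigr),$$ where $\mathcal D(\mathbb N_0^{2k})$ is the set of all downsets (downward closed subsets, including $\emptyset$) of $\mathbb N_0^{2k}=\{0,1,2,\dots\}^{2k}$ with respect to the product ordering, $\le$ is the standard linear ordering on $\{0,1\}$, and products of posets carry the componentwise ordering. -/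

import Mathlib

namespace MultiSorted

/-! ### Operations and clones -/

/-- The `n`-ary `k`-operations on `A`: `k`-tuples of functions `A ^ n → A`. -/
abbrev Op (A : Type) (k n : ℕ) : Type := Fin k → (Fin n → A) → A

/-- All finitary `k`-operations on `A`, of positive arity. -/
abbrev KOp (A : Type) (k : ℕ) : Type := Σ n : ℕ+, Op A k n

/-- Coordinatewise composition of an `m`-ary `k`-operation with `m` many `n`-ary ones. -/
def comp {A : Type} {k m n : ℕ} (f : Op A k m) (g : Fin m → Op A k n) : Op A k n :=
  fun i x => f i (fun j => g j i x)

/-- The `n`-ary projection `k`-operation onto the `i`-th variable. -/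
def proj (A : Type) (k n : ℕ) (i : Fin n) : Op A k n := fun _ x => x i

/-- A `k`-clone: a set of `k`-operations containing all projections and closed under
composition. -/
structure IsClone {A : Type} {k : ℕ} (C : Set (KOp A k)) : Prop where
  proj_mem : ∀ (n : ℕ+) (i : Fin n), (⟨n, proj A k n i⟩ : KOp A k) ∈ C
  comp_mem : ∀ (m n : ℕ+) (f : Op A k m) (g : Fin m → Op A k n),
    (⟨m, f⟩ : KOp A k) ∈ C → (∀ j, (⟨n, g j⟩ : KOp A k) ∈ C) → (⟨n, comp f g⟩ : KOp A k) ∈ C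

/-- The smallest `k`-clone containing `F`. -/
def clo {A : Type} {k : ℕ} (F : Set (KOp A k)) : Set (KOp A k) :=
  ⋂₀ {C | IsClone C ∧ F ⊆ C}

/-- The sets of `k`-operations that are closed with respect to `clo`. As a type, it is ordered by
inclusion. -/
def cloneLattice (A : Type) (k : ℕ) : Set (Set (KOp A k)) := {C | clo C = C}

theorem isClone_clo {A : Type} {k : ℕ} (F : Set (KOp A k)) : IsClone (clo F) where
  proj_mem n i := fun _ hC => hC.1.proj_mem n i
  comp_mem m n f g hf hg := fun C hC =>
    hC.1.comp_mem m n f g (hf C hC) (fun j => hg j C hC)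

/-- The closed sets are precisely the `k`-clones. -/
theorem mem_cloneLattice_iff {A : Type} {k : ℕ} (C : Set (KOp A k)) :
    C ∈ cloneLattice A k ↔ IsClone C := by
  constructor
  · intro h
    have h' : clo C = C := h
    rw [← h']
    exact isClone_clo C
  · intro h
    exact Set.Subset.antisymm (fun f hf => hf C ⟨h, Set.Subset.rfl⟩) (fun f hf D hD => hD.2 hf)

/-! ### Multi-sorted relations on `{0, 1}` -/

/-- A `k`-sorted relation on `{0, 1}` (the field with two elements, so that addition is modulo
two): every variable has a sort among `k` many. -/
structure SortedRel (k : ℕ) : Type where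
  arity : ℕ
  sort : Fin arity → Fin k
  rel : Set (Fin arity → ZMod 2)

/-- The two relations differ only by an order of variables. -/
def Similar {k : ℕ} (ρ σ : SortedRel k) : Prop :=
  ∃ e : Fin ρ.arity ≃ Fin σ.arity,
    (∀ i, σ.sort (e i) = ρ.sort i) ∧ ∀ a : Fin σ.arity → ZMod 2, a ∈ σ.rel ↔ a ∘ e ∈ ρ.rel

/-- The `i`-th variable is dummy: changing its value never matters. -/
def IsDummy {k : ℕ} (ρ : SortedRel k) (i : Fin ρ.arity) : Prop :=
  ∀ (a : Fin ρ.arity → ZMod 2) (c : ZMod 2), a ∈ ρ.rel ↔ Function.update a i c ∈ ρ.rel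

/-- The canonical relations of the first six types, in a fixed order of variables. -/
inductive CanonicalForm {k : ℕ} : SortedRel k → Prop
  /-- `x^i = 0 ∨ y^i = 1` -/
  | c1 (i : Fin k) :
      CanonicalForm ⟨2, ![i, i], {a | a 0 = 0 ∨ a 1 = 1}⟩
  /-- `x^i = y^i ∨ u^j = b` -/
  | c2 (i j : Fin k) (b : ZMod 2) :
      CanonicalForm ⟨3, ![i, i, j], {a | a 0 = a 1 ∨ a 2 = b}⟩
  /-- `x^i = y^i ∨ u^j = v^j`, for distinct sorts -/
  | c3 (i j : Fin k) (hij : i ≠ j) :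
      CanonicalForm ⟨4, ![i, i, j, j], {a | a 0 = a 1 ∨ a 2 = a 3}⟩
  /-- `x^i = y^i ∨ y^i = z^i` -/
  | c3' (i : Fin k) :
      CanonicalForm ⟨3, ![i, i, i], {a | a 0 = a 1 ∨ a 1 = a 2}⟩
  /-- `x^i + y^i = 1` -/
  | c4 (i : Fin k) :
      CanonicalForm ⟨2, ![i, i], {a | a 0 + a 1 = 1}⟩
  /-- `x^i + y^i = u^j + v^j` -/
  | c5 (i j : Fin k) :
      CanonicalForm ⟨4, ![i, i, j, j], {a | a 0 + a 1 = a 2 + a 3}⟩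
  /-- `x^{s_1} + ... + x^{s_n} = b`, for `n ≥ 2` pairwise distinct sorts -/
  | c6 (n : ℕ) (hn : 2 ≤ n) (s : Fin n → Fin k) (hs : Function.Injective s) (b : ZMod 2) :
      CanonicalForm ⟨n, s, {a | ∑ i, a i = b}⟩

/-- The set of all `k`-sorted canonical relations of the first six types: relations without dummy
variables which have one of the six forms up to an order of variables. -/
def CR16 (k : ℕ) : Set (SortedRel k) :=
  {ρ | (∀ i, ¬ IsDummy ρ i) ∧ ∃ σ, CanonicalForm σ ∧ Similar σ ρ}

/-! ### Embeddings of posets -/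

/-- `Q` embeds into `P`: there is an injective order-preserving map from `Q` to `P`. -/
def PosetEmbeds (Q P : Type) [PartialOrder Q] [PartialOrder P] : Prop :=
  ∃ ν : Q → P, Function.Injective ν ∧ ∀ p q : Q, p ≤ q → ν p ≤ ν q

end MultiSorted

namespace MultiSorted

/-! ### Maximal relations of idempotent Boolean operations avoiding the zero tuple -/

/-! A clone is recovered from its unary members, its idempotent members and its members with a
constant component (`clone_le_of_idempotent`): every other member arises from an idempotent one by
substituting and applying unary ones.

The idempotent part is determined by its invariant ternary relations and invariant clauses
(`idempotent_clone_le`). This is interpolation on finite sets of points. At a smallest failure, with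
at least four points, shift the wanted tuple of values to zero and enlarge the attainable tuples to
a maximal invariant set `R` omitting zero. By `MaxAvoid.exists_eq_compl`, `R` is the complement of a
subgroup `W` of a power of the two-element field. A resolution argument (`resolution_contra`) leaves
only the case where `W` is trivial and the wanted values depend on the sort alone; then `R` is a
clause, and equality of the invariant clauses gives a contradiction.

For a fixed vector of literals the invariant clauses form a downset of `ℕ ^ k`. These finitely many
downsets, together with finitely many yes/no data (ternary relations, missing unary operations), are
packed into one downset of `ℕ ^ (2k)`. For each sort and each constant, deleting the constant
component and adjoining the projections gives a `(k-1)`-clone, and one bit remembers whether a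
projection was already there. An embedding need not reflect the order, so the factor of canonical
relations only has to be monotone; the other two give injectivity. -/

theorem zmod2_cases (x : ZMod 2) : x = 0 ∨ x = 1 := by
  revert x; decide

theorem zmod2_ne_zero {x : ZMod 2} : x ≠ 0 ↔ x = 1 := by
  revert x; decide

theorem zmod2_ne_one {x : ZMod 2} : x ≠ 1 ↔ x = 0 := by
  revert x; decide

theorem zmod2_add_self (x : ZMod 2) : x + x = 0 := by
  revert x; decide

/-- Apply an operation which acts on every coordinate separately to a family of tuples. -/
def applyAt {ι : Type} {m : ℕ} (g : ι → (Fin m → ZMod 2) → ZMod 2) (c : Fin m → ι → ZMod 2) :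
    ι → ZMod 2 :=
  fun x => g x (fun l => c l x)

/-- The set of tuples `R` is invariant under the operations in `J`. -/
def InvUnder {ι : Type} (J : ∀ m : ℕ, Set (ι → (Fin m → ZMod 2) → ZMod 2))
    (R : Set (ι → ZMod 2)) : Prop :=
  ∀ m, ∀ g ∈ J m, ∀ c : Fin m → ι → ZMod 2, (∀ l, c l ∈ R) → applyAt g c ∈ R

/-- All operations in `J` are idempotent. -/
def Idem {ι : Type} (J : ∀ m : ℕ, Set (ι → (Fin m → ZMod 2) → ZMod 2)) : Prop :=
  ∀ m, ∀ g ∈ J m, ∀ x b, g x (fun _ => b) = b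

/-- The indicator tuple of a finite set of coordinates. -/
def ind {ι : Type} [DecidableEq ι] (Z : Finset ι) : ι → ZMod 2 := fun x => if x ∈ Z then 1 else 0

/-- `R` is a largest `J`-invariant set among those which omit the zero tuple. -/
structure MaxAvoid {ι : Type} (J : ∀ m : ℕ, Set (ι → (Fin m → ZMod 2) → ZMod 2))
    (R : Set (ι → ZMod 2)) : Prop where
  inv : InvUnder J R
  zero : (0 : ι → ZMod 2) ∉ R
  max : ∀ S, InvUnder J S → (0 : ι → ZMod 2) ∉ S → R ⊆ S → S ⊆ R

theorem exists_maxAvoid {ι : Type} [Finite ι]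
    (J : ∀ m : ℕ, Set (ι → (Fin m → ZMod 2) → ZMod 2))
    (S : Set (ι → ZMod 2)) (hS : InvUnder J S) (h0 : (0 : ι → ZMod 2) ∉ S) :
    ∃ R, S ⊆ R ∧ MaxAvoid J R := by
  obtain ⟨R, hSR, hR⟩ := (Set.toFinite {R : Set (ι → ZMod 2) | InvUnder J R ∧
    (0 : ι → ZMod 2) ∉ R}).exists_le_maximal ⟨hS, h0⟩
  exact ⟨R, hSR, hR.prop.1, hR.prop.2, fun T hT h0T hRT => hR.le_of_ge ⟨hT, h0T⟩ hRT⟩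

section Core

variable {ι : Type} [DecidableEq ι]
  {J : ∀ m : ℕ, Set (ι → (Fin m → ZMod 2) → ZMod 2)} {R : Set (ι → ZMod 2)}

/-- Monotonicity at `i` makes the upward closure of `R` in coordinate `i` invariant, and raising an
entry never creates the zero tuple; so maximality puts this closure inside `R`. -/
theorem MaxAvoid.update_mem (hR : MaxAvoid J R) (i : ι)
    (hmon : ∀ m, ∀ g ∈ J m, ∀ a a' : Fin m → ZMod 2, (∀ l, a l = 1 → a' l = 1) →
      g i a = 1 → g i a' = 1)
    (c : ι → ZMod 2) (hc : c ∈ R) : Function.update c i 1 ∈ R := by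
  let S : Set (ι → ZMod 2) :=
    {d | ∃ c ∈ R, (∀ x, x ≠ i → c x = d x) ∧ (c i = 1 → d i = 1)}
  have hS : S ⊆ R := by
    refine hR.max S ?_ ?_ ?_
    · intro m g hg d hd
      choose c hcR hcd hci using hd
      refine ⟨applyAt g c, hR.inv m g hg c hcR, ?_, ?_⟩
      · intro x hx
        simp only [applyAt]
        congr 1
        funext l
        exact hcd l x hx
      · exact hmon m g hg _ _ hci
    · rintro ⟨c, hcR, hcd, hci⟩
      apply hR.zero
      have : c = 0 := by
        funext x
        by_cases hx : x = i
        · subst hx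
          by_contra hne
          have := hci (zmod2_ne_zero.1 hne)
          simp at this
        · exact hcd x hx
      rwa [← this]
    · intro c hc
      exact ⟨c, hc, fun _ _ => rfl, id⟩
  apply hS
  refine ⟨c, hc, ?_, ?_⟩
  · intro x hx
    simp [hx]
  · intro _
    simp

theorem MaxAvoid.exists_nonmonotone (hR : MaxAvoid J R) {Z : Finset ι} {i : ι} (hi : i ∈ Z)
    (hZ : ind Z ∉ R) (hZi : ind (Z.erase i) ∈ R) :
    ∃ m, ∃ g ∈ J m, ∃ a a' : Fin m → ZMod 2, (∀ l, a l = 1 → a' l = 1) ∧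
      g i a = 1 ∧ g i a' = 0 := by
  by_contra hcon
  push Not at hcon
  apply hZ
  have := hR.update_mem i (fun m g hg a a' haa h1 => zmod2_ne_zero.1 (hcon m g hg a a' haa h1))
    _ hZi
  convert this using 1
  funext x
  by_cases hx : x = i
  · subst hx; simp [ind, hi]
  · simp [ind, hx]

/-- With three elements in `Z`, an operation that is not monotone at one of them combines indicators
of proper subsets of `Z` either to `ind Z` or to zero, both of which lie outside `R`. -/
theorem MaxAvoid.card_le_two (hR : MaxAvoid J R) (hJ : Idem J) {Z : Finset ι}
    (hne : Z.Nonempty) (hZ : ind Z ∉ R)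
    (hmin : ∀ Y ⊆ Z, Y.Nonempty → Y ≠ Z → ind Y ∈ R) : Z.card ≤ 2 := by
  by_contra hcard
  push Not at hcard
  obtain ⟨i, j, l, hi, hj, hl, hij, hil, hjl⟩ := Finset.two_lt_card_iff.1 hcard
  have herase : ∀ x ∈ Z, ind (Z.erase x) ∈ R := by
    intro x hx
    refine hmin _ (Finset.erase_subset _ _) ?_ ?_
    · rw [← Finset.card_pos, Finset.card_erase_of_mem hx]; omega
    · intro h
      have := Finset.notMem_erase x Z
      rw [h] at this
      exact this hx
  obtain ⟨m, g, hg, a, a', haa, h1, h0⟩ := hR.exists_nonmonotone hi hZ (herase i hi)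
  have hsub : ∀ Y : Finset ι, Y ⊆ {i, j} → Y.Nonempty → ind Y ∈ R := by
    intro Y hY hYne
    refine hmin Y (hY.trans ?_) hYne ?_
    · intro x hx
      simp only [Finset.mem_insert, Finset.mem_singleton] at hx
      rcases hx with rfl | rfl <;> assumption
    · rintro rfl
      have := hY hl
      simp [hil.symm, hjl.symm] at this
  -- the operation sends the complement of `a` to zero in the coordinate `j`
  have hstep1 : g j (fun t => a t + 1) = 0 := by
    by_contra hne1
    have hne1 := zmod2_ne_zero.1 hne1
    apply hZ
    -- The inputs read `a` at `i`, its complement at `j` and constants elsewhere, so the value would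
    -- be `ind Z`.
    have := hR.inv m g hg (fun t => if a t = 1 then ind (Z.erase j) else ind (Z.erase i)) (by
      intro t
      split_ifs
      · exact herase j hj
      · exact herase i hi)
    convert this using 1
    funext x
    simp only [applyAt]
    by_cases hxi : x = i
    · subst hxi
      have : (fun t => (if a t = 1 then ind (Z.erase j) else ind (Z.erase x)) x) = a := by
        funext t
        rcases zmod2_cases (a t) with h | h <;> simp [h, ind, hi, hij]
      rw [this, h1]; simp [ind, hi]
    · by_cases hxj : x = j
      · subst hxj
        have : (fun t => (if a t = 1 then ind (Z.erase x) else ind (Z.erase i)) x)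
            = fun t => a t + 1 := by
          funext t
          rcases zmod2_cases (a t) with h | h <;> simp [h, ind, hj, hij.symm]
          decide
        rw [this, hne1]; simp [ind, hj]
      · have : (fun t => (if a t = 1 then ind (Z.erase j) else ind (Z.erase i)) x)
            = fun _ => ind Z x := by
          funext t
          rcases zmod2_cases (a t) with h | h <;> simp [h, ind, hxi, hxj]
        rw [this, hJ m g hg]
  apply hR.zero
  -- Here the inputs read `a'` at `i` and, because `a ≤ a'`, again the complement of `a` at `j`; the
  -- result is the zero tuple.
  have := hR.inv m g hg (fun t => if a' t = 1 then (if a t = 1 then ind {i} else ind {i, j})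
      else ind {j}) (by
    intro t
    split_ifs
    · exact hsub _ (by simp) (by simp)
    · exact hsub _ (by simp) (by simp)
    · exact hsub _ (by simp) (by simp))
  convert this using 1
  funext x
  simp only [applyAt]
  by_cases hxi : x = i
  · subst hxi
    have : (fun t => (if a' t = 1 then (if a t = 1 then ind {x} else ind {x, j})
      else ind {j}) x) = a' := by
      funext t
      rcases zmod2_cases (a' t) with h | h <;> rcases zmod2_cases (a t) with h' | h' <;>
        simp [h, h', ind, hij]
    rw [this, h0]; rfl
  · by_cases hxj : x = j
    · subst hxj
      have : (fun t => (if a' t = 1 then (if a t = 1 then ind {i} else ind {i, x})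
        else ind {x}) x) = fun t => a t + 1 := by
        funext t
        have := haa t
        rcases zmod2_cases (a' t) with h | h <;> rcases zmod2_cases (a t) with h' | h' <;>
          simp [h, h', ind, hij.symm] at this ⊢
        decide
      rw [this, hstep1]; rfl
    · have : (fun t => (if a' t = 1 then (if a t = 1 then ind {i} else ind {i, j})
        else ind {j}) x) = fun _ => 0 := by
        funext t
        split_ifs <;> simp [ind, hxi, hxj]
      rw [this, hJ m g hg]; rfl

/-- Since neither zero nor `ind {i, j}` is in `R`, every operation acts at `j` as the dual of its
action at `i`. A non-monotone one therefore yields a polynomial that flips the entries `i` and `j`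
and fixes all others. -/
theorem MaxAvoid.add_pair_mem (hR : MaxAvoid J R) (hJ : Idem J)
    (hsing : ∀ i, ind {i} ∈ R) {i j : ι} (hij : i ≠ j) (hZ : ind {i, j} ∉ R)
    {c : ι → ZMod 2} (hc : c ∈ R) : c + ind {i, j} ∈ R := by
  have herase : ({i, j} : Finset ι).erase i = {j} := by
    ext x; simp only [Finset.mem_erase, Finset.mem_insert, Finset.mem_singleton]; grind
  obtain ⟨m, g, hg, a, a', haa, h1, h0⟩ :=
    hR.exists_nonmonotone (Z := {i, j}) (i := i) (by simp) hZ (by rw [herase]; exact hsing j)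
  have hlink : ∀ w : Fin m → ZMod 2, g j (fun t => w t + 1) = g i w + 1 := by
    intro w
    have hmem := hR.inv m g hg (fun t => if w t = 1 then ind {i} else ind {j}) (by
      intro t
      split_ifs
      · exact hsing i
      · exact hsing j)
    have hval : applyAt g (fun t => if w t = 1 then ind {i} else ind {j}) =
        fun x => if x = i then g i w else if x = j then g j (fun t => w t + 1) else 0 := by
      funext x
      simp only [applyAt]
      by_cases hxi : x = i
      · subst hxi
        rw [if_pos rfl]
        congr 1
        funext t
        rcases zmod2_cases (w t) with h | h <;> simp [h, ind, hij]
      · rw [if_neg hxi]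
        by_cases hxj : x = j
        · subst hxj
          rw [if_pos rfl]
          congr 1
          funext t
          rcases zmod2_cases (w t) with h | h <;> simp [h, ind, hxi]
          decide
        · rw [if_neg hxj]
          have : (fun t => (if w t = 1 then ind {i} else ind {j}) x) = fun _ => 0 := by
            funext t
            split_ifs <;> simp [ind, hxi, hxj]
          rw [this, hJ m g hg]
    rw [hval] at hmem
    rcases zmod2_cases (g i w) with hA | hA <;>
      rcases zmod2_cases (g j (fun t => w t + 1)) with hB | hB
    · exfalso
      apply hR.zero
      convert hmem using 1
      funext x
      simp [hA, hB]
    · simp [hA, hB]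
    · rw [hA, hB]; decide
    · exfalso
      apply hZ
      convert hmem using 1
      funext x
      simp only [hA, hB, ind, Finset.mem_insert, Finset.mem_singleton]
      grind
  -- At `i` these inputs read `a` if `c i = 0` and `a'` if `c i = 1`, so `g` negates `c i`.
  let G : (ι → ZMod 2) → Fin m → ι → ZMod 2 := fun c t =>
    if a t = 1 then ind {i} else if a' t = 1 then c else ind {j}
  have hGmem : ∀ c ∈ R, applyAt g (G c) ∈ R := by
    intro c hc
    refine hR.inv m g hg _ ?_
    intro t
    simp only [G]
    split_ifs
    · exact hsing i
    · exact hc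
    · exact hsing j
  have hGi : ∀ c, applyAt g (G c) i = c i + 1 := by
    intro c
    simp only [applyAt, G]
    rcases zmod2_cases (c i) with h | h
    · rw [h, zero_add]
      refine Eq.trans ?_ h1
      congr 1
      funext t
      rcases zmod2_cases (a' t) with h' | h' <;> rcases zmod2_cases (a t) with h'' | h'' <;>
        simp [h, h', h'', ind, hij]
    · rw [h, zmod2_add_self]
      refine Eq.trans ?_ h0
      congr 1
      funext t
      have := haa t
      rcases zmod2_cases (a' t) with h' | h' <;> rcases zmod2_cases (a t) with h'' | h'' <;>
        simp [h, h', h'', ind, hij] at this ⊢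
  have hGj : ∀ c, applyAt g (G c) j = c j + 1 := by
    intro c
    simp only [applyAt, G]
    rcases zmod2_cases (c j) with h | h
    · have := hlink a'
      rw [h0, zero_add] at this
      rw [h, zero_add]
      refine Eq.trans ?_ this
      congr 1
      funext t
      have := haa t
      rcases zmod2_cases (a' t) with h' | h' <;> rcases zmod2_cases (a t) with h'' | h'' <;>
        simp [h, h', h'', ind, hij.symm, zmod2_add_self] at this ⊢
    · have := hlink a
      rw [h1] at this
      rw [h]
      refine Eq.trans ?_ this
      congr 1
      funext t
      have := haa t
      rcases zmod2_cases (a' t) with h' | h' <;> rcases zmod2_cases (a t) with h'' | h'' <;>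
        simp [h, h', h'', ind, hij.symm, zmod2_add_self] at this ⊢
  have hG0 : ∀ c x, x ≠ i → x ≠ j → c x = 0 → applyAt g (G c) x = 0 := by
    intro c x hxi hxj hcx
    simp only [applyAt, G]
    have : (fun t => (if a t = 1 then ind {i} else if a' t = 1 then c else ind {j}) x)
        = fun _ => 0 := by
      funext t
      split_ifs <;> simp [ind, hxi, hxj, hcx]
    rw [this, hJ m g hg]
  have hG1 : ∀ c x, x ≠ i → x ≠ j → c x = 1 → applyAt g (G c) x = 1 := by
    intro c x hxi hxj hcx
    -- Only the entry at `x` matters, so `c` may be replaced by `ind {x}`; losing that entry would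
    -- produce `ind {i, j}`.
    have hval : applyAt g (G c) x = applyAt g (G (ind {x})) x := by
      simp only [applyAt, G]
      congr 1
      funext t
      split_ifs <;> simp [ind, hcx]
    rw [hval]
    by_contra hne
    apply hZ
    have hmem := hGmem _ (hsing x)
    convert hmem using 1
    funext y
    by_cases hyi : y = i
    · subst hyi
      rw [hGi]; simp [ind, Ne.symm hxi]
    · by_cases hyj : y = j
      · subst hyj
        rw [hGj]; simp [ind, Ne.symm hxj]
      · by_cases hyx : y = x
        · subst hyx
          rw [zmod2_ne_one.1 hne]; simp [ind, hyi, hyj]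
        · rw [hG0 _ y hyi hyj (by simp [ind, hyx])]; simp [ind, hyi, hyj]
  have hmem := hGmem c hc
  convert hmem using 1
  funext y
  by_cases hyi : y = i
  · subst hyi
    rw [hGi]; simp [ind]
  · by_cases hyj : y = j
    · subst hyj
      rw [hGj]; simp [ind]
    · rcases zmod2_cases (c y) with h | h
      · rw [hG0 c y hyi hyj h]; simp [ind, hyi, hyj, h]
      · rw [hG1 c y hyi hyj h]; simp [ind, hyi, hyj, h]

theorem ind_support [Fintype ι] (c : ι → ZMod 2) :
    ind (Finset.univ.filter (fun x => c x ≠ 0)) = c := by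
  funext x
  rcases zmod2_cases (c x) with h | h <;> simp [ind, h]

/-- A maximal invariant set which omits only the zero tuple among the tuples with at most one
non-zero entry is the complement of a subgroup. -/
theorem MaxAvoid.exists_eq_compl [Fintype ι] (hR : MaxAvoid J R) (hJ : Idem J)
    (hsing : ∀ i, ind {i} ∈ R) :
    ∃ W : AddSubgroup (ι → ZMod 2), (∀ c, c ∈ R ↔ c ∉ W) ∧
      (W = ⊥ ∨ ∃ i j, i ≠ j ∧ ind {i, j} ∈ W) := by
  -- The subgroup is generated by the omitted pairs. Any omitted nonzero tuple has such a pair in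
  -- its support, and subtracting it shrinks the support.
  let E : Set (ι → ZMod 2) := {e | ∃ i j, i ≠ j ∧ ind {i, j} ∉ R ∧ e = ind {i, j}}
  have hclos : ∀ w ∈ AddSubgroup.closure E, ∀ c ∈ R, c + w ∈ R := by
    intro w hw
    induction hw using AddSubgroup.closure_induction with
    | mem x hx =>
      obtain ⟨i, j, hij, hZ, rfl⟩ := hx
      intro c hc
      exact hR.add_pair_mem hJ hsing hij hZ hc
    | zero => intro c hc; simpa using hc
    | add x y _ _ hx hy => intro c hc; rw [← add_assoc]; exact hy _ (hx _ hc)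
    | neg x _ hx =>
      intro c hc
      have : -x = x := by
        funext t
        have := zmod2_add_self (x t)
        simp only [Pi.neg_apply]
        exact neg_eq_of_add_eq_zero_left this
      rw [this]; exact hx c hc
  have hsm : ∀ n, ∀ c : ι → ZMod 2, (Finset.univ.filter (fun x => c x ≠ 0)).card ≤ n → c ∉ R →
      c ∈ AddSubgroup.closure E := by
    intro n
    induction n with
    | zero =>
      intro c hn _
      have : c = 0 := by
        funext x
        by_contra hx
        have : x ∈ Finset.univ.filter (fun x => c x ≠ 0) := by simpa using hx
        rw [Finset.card_eq_zero.1 (Nat.le_zero.1 hn)] at this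
        simp at this
      rw [this]; exact zero_mem _
    | succ n ih =>
      intro c hn hc
      by_cases hc0 : c = 0
      · rw [hc0]; exact zero_mem _
      classical
      let 𝒵 : Finset (Finset ι) := (Finset.univ.filter (fun x => c x ≠ 0)).powerset.filter
        (fun Z => Z.Nonempty ∧ ind Z ∉ R)
      have h𝒵 : 𝒵.Nonempty := by
        refine ⟨Finset.univ.filter (fun x => c x ≠ 0), ?_⟩
        simp only [𝒵, Finset.mem_filter, Finset.mem_powerset, subset_refl, true_and]
        refine ⟨?_, by rwa [ind_support]⟩
        obtain ⟨x, hx⟩ := Function.ne_iff.1 hc0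
        exact ⟨x, by simpa using hx⟩
      obtain ⟨Z, hZ𝒵, hZmin⟩ := Finset.exists_minimal h𝒵
      simp only [𝒵, Finset.mem_filter, Finset.mem_powerset] at hZ𝒵
      obtain ⟨hZc, hZne, hZR⟩ := hZ𝒵
      have hle : Z.card ≤ 2 := by
        refine hR.card_le_two hJ hZne hZR ?_
        intro Y hYZ hYne hne
        by_contra hY
        apply hne
        refine Finset.Subset.antisymm hYZ (hZmin ?_ hYZ)
        simp only [𝒵, Finset.mem_filter, Finset.mem_powerset]
        exact ⟨hYZ.trans hZc, hYne, hY⟩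
      have hcard : Z.card = 2 := by
        have h0 := Finset.card_pos.2 hZne
        have h1 : Z.card ≠ 1 := by
          intro h
          obtain ⟨x, rfl⟩ := Finset.card_eq_one.1 h
          exact hZR (hsing x)
        omega
      obtain ⟨i, j, hij, rfl⟩ := Finset.card_eq_two.1 hcard
      have hE : ind {i, j} ∈ AddSubgroup.closure E :=
        AddSubgroup.subset_closure ⟨i, j, hij, hZR, rfl⟩
      have hci : c i = 1 := zmod2_ne_zero.1 (by
        have := hZc (show i ∈ ({i, j} : Finset ι) by simp)
        simpa using this)
      have hcj : c j = 1 := zmod2_ne_zero.1 (by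
        have := hZc (show j ∈ ({i, j} : Finset ι) by simp)
        simpa using this)
      have hadd : c + ind {i, j} + ind {i, j} = c := by
        funext x
        simp only [Pi.add_apply, add_assoc, zmod2_add_self, add_zero]
      have hnot : c + ind {i, j} ∉ R := by
        intro h
        apply hc
        rw [← hadd]
        exact hclos _ hE _ h
      have hlt : (Finset.univ.filter (fun x => (c + ind {i, j}) x ≠ 0)).card ≤ n := by
        have hlt' : (Finset.univ.filter (fun x => (c + ind {i, j}) x ≠ 0)) ⊂
            Finset.univ.filter (fun x => c x ≠ 0) := by
          refine Finset.ssubset_iff_of_subset ?_ |>.2 ⟨i, by simp [hci], ?_⟩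
          · intro x hx
            by_cases hxi : x = i
            · subst hxi; simp [hci]
            · by_cases hxj : x = j
              · subst hxj; simp [hcj]
              · simpa [ind, hxi, hxj] using hx
          · simp only [Finset.mem_filter, Finset.mem_univ, true_and, not_not, Pi.add_apply, hci,
              ind, Finset.mem_insert, true_or, if_true]
            decide
        have := Finset.card_lt_card hlt'
        omega
      rw [← hadd]
      exact add_mem (ih _ hlt hnot) hE
  refine ⟨AddSubgroup.closure E, ?_, ?_⟩
  · intro c
    constructor
    · intro hc hW
      apply hR.zero
      have := hclos c hW c hc
      have h0 : c + c = 0 := by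
        funext x; exact zmod2_add_self _
      rwa [h0] at this
    · intro hW
      by_contra hc
      exact hW (hsm _ c le_rfl hc)
  · by_cases hE : E = ∅
    · left; rw [hE]; exact AddSubgroup.closure_empty
    · right
      obtain ⟨e, i, j, hij, hZ, rfl⟩ := Set.nonempty_iff_ne_empty.2 hE
      exact ⟨i, j, hij, AddSubgroup.subset_closure ⟨i, j, hij, hZ, rfl⟩⟩

end Core

/-- Resolution on a pair of coordinates: an operation which is compatible with all the relations
`{c ∈ R | c p = 0}` cannot produce the zero tuple. -/
theorem resolution_contra {ι : Type} [DecidableEq ι] {M : ℕ} {R : Set (ι → ZMod 2)}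
    (W : AddSubgroup (ι → ZMod 2)) (hW : ∀ c, c ∈ R ↔ c ∉ W) (hsing : ∀ i, ind {i} ∈ R)
    (f : ι → (Fin M → ZMod 2) → ZMod 2) (hf0 : ∀ x, f x (fun _ => 0) = 0)
    (hH : ∀ p, ∀ c : Fin M → ι → ZMod 2, (∀ l, c l ∈ R) → (∀ l, c l p = 0) → applyAt f c ∈ R)
    {i j p q : ι} (hij : i ≠ j) (hpi : p ≠ i) (hpj : p ≠ j) (hqi : q ≠ i) (hqj : q ≠ j)
    (hpq : p ≠ q)
    (hedge : ind {i, j} ∈ W ∨ (W = ⊥ ∧ ∀ w, f j w = f i (fun t => w t + 1) + 1))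
    (c : Fin M → ι → ZMod 2) (hc : ∀ l, c l ∈ R) (hfc : applyAt f c = 0) : False := by
  have hzero : (0 : ι → ZMod 2) ∉ R := by rw [hW]; simp [zero_mem]
  -- The tuple `c` is cut into two pieces linked by a fresh bit `b`: `u` vanishes at `q` and `s` at
  -- `p`, so `hH` applies to each. The two pieces with opposite bits add up to `c` or to `c + ind
  -- {i, j}`, which forces some `b` to put both in `R`.
  let u : (ι → ZMod 2) → ZMod 2 → ι → ZMod 2 := fun c b x =>
    if x = i then c i else if x = j then b else if x = p then c p else 0
  let s : (ι → ZMod 2) → ZMod 2 → ι → ZMod 2 := fun c b x =>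
    if x = i then b + 1 else if x = p then 0 else c x
  have hsplit : ∀ c ∈ R, ∃ b, u c b ∈ R ∧ s c b ∈ R := by
    intro c hc
    by_contra hcon
    push Not at hcon
    have hu : u c 0 ∈ W → u c 1 ∈ W → False := by
      intro h0 h1
      apply (hW _).1 (hsing j)
      have := add_mem h0 h1
      convert this using 1
      funext x
      simp only [u, ind, Pi.add_apply, Finset.mem_singleton]
      split_ifs <;> simp_all [zmod2_add_self]
    have hs : s c 0 ∈ W → s c 1 ∈ W → False := by
      intro h0 h1
      apply (hW _).1 (hsing i)
      have := add_mem h0 h1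
      convert this using 1
      funext x
      simp only [s, ind, Pi.add_apply, Finset.mem_singleton]
      split_ifs <;> simp_all [zmod2_add_self]
    have hus0 : u c 0 ∈ W → s c 1 ∈ W → False := by
      intro h0 h1
      apply (hW _).1 hc
      have := add_mem h0 h1
      convert this using 1
      funext x
      simp only [u, s, Pi.add_apply]
      split_ifs <;> simp_all [zmod2_add_self]
    have hus1 : u c 1 ∈ W → s c 0 ∈ W → False := by
      intro h0 h1
      rcases hedge with hZ | ⟨hbot, -⟩
      · apply (hW _).1 hc
        have := add_mem (add_mem h0 h1) hZ
        convert this using 1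
        funext x
        simp only [u, s, ind, Pi.add_apply, Finset.mem_insert, Finset.mem_singleton]
        split_ifs <;> simp_all [zmod2_add_self, add_assoc]
        rw [add_comm (c j) 1, ← add_assoc, zmod2_add_self, zero_add]
      · rw [hbot, AddSubgroup.mem_bot] at h0
        have := congrFun h0 j
        simp [u, hij.symm] at this
    have H0 := hcon 0
    have H1 := hcon 1
    rw [hW, hW] at H0 H1
    tauto
  choose b hub hsb using fun l => hsplit (c l) (hc l)
  have hfx : ∀ x, f x (fun l => c l x) = 0 := fun x => congrFun hfc x
  have hU := hH q (fun l => u (c l) (b l)) hub (fun l => by simp [u, hqi, hqj, hpq.symm])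
  have hV := hH p (fun l => s (c l) (b l)) hsb (fun l => by simp [s, hpi])
  have hbj : f j b = 1 := by
    by_contra hne
    apply hzero
    convert hU using 1
    funext x
    simp only [applyAt, u, Pi.zero_apply]
    by_cases hxi : x = i
    · subst hxi; simp [hfx]
    by_cases hxj : x = j
    · subst hxj; simp [hxi, zmod2_ne_one.1 hne]
    by_cases hxp : x = p
    · subst hxp; simp [hxi, hxj, hfx]
    · simp [hxi, hxj, hxp, hf0]
  have hbi : f i (fun l => b l + 1) = 1 := by
    by_contra hne
    apply hzero
    convert hV using 1
    funext x
    simp only [applyAt, s, Pi.zero_apply]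
    by_cases hxi : x = i
    · subst hxi; simp [zmod2_ne_one.1 hne]
    by_cases hxp : x = p
    · subst hxp; simp [hxi, hf0]
    · simp [hxi, hxp, hfx]
  rcases hedge with hZ | ⟨-, hdual⟩
  · have hmem := hH p (fun l => if b l = 1 then ind {j} else ind {i})
      (fun l => by split_ifs <;> apply hsing)
      (fun l => by split_ifs <;> simp [ind, hpi, hpj])
    apply (hW _).1 hmem
    convert hZ using 1
    funext x
    simp only [applyAt]
    by_cases hxi : x = i
    · subst hxi
      have : (fun l => (if b l = 1 then ind {j} else ind {x}) x) = fun l => b l + 1 := by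
        funext l
        rcases zmod2_cases (b l) with h | h <;> simp [h, ind, hij, zmod2_add_self]
      rw [this, hbi]; simp [ind]
    by_cases hxj : x = j
    · subst hxj
      have : (fun l => (if b l = 1 then ind {x} else ind {i}) x) = b := by
        funext l
        rcases zmod2_cases (b l) with h | h <;> simp [h, ind, hxi]
      rw [this, hbj]; simp [ind]
    · have : (fun l => (if b l = 1 then ind {j} else ind {i}) x) = fun _ => 0 := by
        funext l
        split_ifs <;> simp [ind, hxi, hxj]
      rw [this, hf0]; simp [ind, hxi, hxj]
  · have := hdual b
    rw [hbi, hbj] at this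
    revert this
    decide

end MultiSorted
namespace MultiSorted

/-! ### Clones of idempotent operations -/

section Idempotent

variable {k : ℕ}

/-- All members of `I` are idempotent. -/
def IsIdem (I : Set (KOp (ZMod 2) k)) : Prop :=
  ∀ (n : ℕ+) (f : Op (ZMod 2) k n), (⟨n, f⟩ : KOp (ZMod 2) k) ∈ I → ∀ i b, f i (fun _ => b) = b

/-- The ternary relation `R` with sorts `σ` is invariant under `I`. -/
def PresThree (I : Set (KOp (ZMod 2) k)) (σ : Fin 3 → Fin k) (R : Set (Fin 3 → ZMod 2)) : Prop :=
  ∀ (n : ℕ+) (f : Op (ZMod 2) k n), (⟨n, f⟩ : KOp (ZMod 2) k) ∈ I →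
    ∀ c : Fin n → Fin 3 → ZMod 2, (∀ l, c l ∈ R) → (fun x => f (σ x) (fun l => c l x)) ∈ R

/-- The numbers `v s` of literals `x^s ≠ b s` for which the clause is invariant under `I`: whenever
a member of `I` sends at most `v s` tuples of each sort `s` to `b s`, these tuples have a common
position at which all of them have the value `b s`. -/
def clauseSet (I : Set (KOp (ZMod 2) k)) (b : Fin k → ZMod 2) : LowerSet (Fin k → ℕ) where
  carrier := {v | ∀ (n : ℕ+) (f : Op (ZMod 2) k n), (⟨n, f⟩ : KOp (ZMod 2) k) ∈ I →
    ∀ X : Fin k → Finset (Fin n → ZMod 2), (∀ s, (X s).card ≤ v s) →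
      (∀ s, ∀ r ∈ X s, f s r = b s) → ∃ l, ∀ s, ∀ r ∈ X s, r l = b s}
  lower' := fun _ _ hwv hv n f hf X hX => hv n f hf X (fun s => (hX s).trans (hwv s))

/-- `f` agrees on the points of `P` with a member of `I`. -/
def Interp (I : Set (KOp (ZMod 2) k)) {n : ℕ+} (f : Op (ZMod 2) k n)
    (P : Finset (Fin k × (Fin n → ZMod 2))) : Prop :=
  ∃ g : Op (ZMod 2) k n, (⟨n, g⟩ : KOp (ZMod 2) k) ∈ I ∧ ∀ p ∈ P, g p.1 p.2 = f p.1 p.2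

/-! ### Interpolation of idempotent operations on finite sets of points -/

theorem exists_cover {α β : Type} (A : Finset α) (X : Finset β) (h : X.card ≤ A.card) (d : β) :
    ∃ φ : α → β, (∀ r ∈ X, ∃ a ∈ A, φ a = r) ∧ ∀ a, φ a ∈ X ∨ φ a = d := by
  classical
  obtain ⟨A', hA', hcard⟩ := Finset.exists_subset_card_eq h
  let e := Finset.equivOfCardEq hcard
  refine ⟨fun a => if h : a ∈ A' then (e ⟨a, h⟩ : β) else d, ?_, ?_⟩
  · intro r hr
    refine ⟨e.symm ⟨r, hr⟩, hA' (e.symm ⟨r, hr⟩).2, ?_⟩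
    simp
  · intro a
    by_cases h : a ∈ A'
    · left; simp [h]
    · right; simp [h]

/-- The value triples of members of `I` at three points form an invariant ternary relation
containing the triples of the projections; `f` preserves it and maps those triples to its own
values. -/
theorem interp_of_card_le_three {I I' : Set (KOp (ZMod 2) k)} (hI : IsClone I)
    (hthree : ∀ σ R, PresThree I σ R → PresThree I' σ R) {n : ℕ+} {f : Op (ZMod 2) k n}
    (hf : (⟨n, f⟩ : KOp (ZMod 2) k) ∈ I') (P : Finset (Fin k × (Fin n → ZMod 2)))
    (hP : P.card ≤ 3) : Interp I f P := by
  rcases P.eq_empty_or_nonempty with rfl | ⟨d, hd⟩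
  · exact ⟨proj _ k n ⟨0, n.pos⟩, hI.proj_mem n _, by simp⟩
  obtain ⟨e, he, -⟩ := exists_cover (Finset.univ : Finset (Fin 3)) P (by simpa using hP) d
  have hpres : PresThree I (fun x => (e x).1)
      {c | ∃ g : Op (ZMod 2) k n, (⟨n, g⟩ : KOp (ZMod 2) k) ∈ I ∧
        ∀ x, c x = g (e x).1 (e x).2} := by
    intro m h hh c hc
    choose g hg hgc using hc
    refine ⟨comp h g, hI.comp_mem m n h g hh hg, ?_⟩
    intro x
    simp only [comp, hgc]
  obtain ⟨g, hg, hgf⟩ := hthree _ _ hpres n f hf (fun l x => (e x).2 l)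
    (fun l => ⟨proj _ k n l, hI.proj_mem n l, fun x => rfl⟩)
  refine ⟨g, hg, ?_⟩
  intro p hp
  obtain ⟨x, -, rfl⟩ := he p hp
  exact (hgf x).symm

/-- The bound `3 ≤ N` leaves two further points `p`, `q` beside any pair `i`, `j`, as resolution
requires. -/
theorem interp_succ {I I' : Set (KOp (ZMod 2) k)} (hI : IsClone I) (hidem : IsIdem I)
    (hidem' : IsIdem I') (hclause : ∀ b, clauseSet I b ≤ clauseSet I' b) {N : ℕ} (hN : 3 ≤ N)
    (ih : ∀ (n : ℕ+) (f : Op (ZMod 2) k n), (⟨n, f⟩ : KOp (ZMod 2) k) ∈ I' →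
      ∀ P : Finset (Fin k × (Fin n → ZMod 2)), P.card ≤ N → Interp I f P)
    {n : ℕ+} {f : Op (ZMod 2) k n} (hf : (⟨n, f⟩ : KOp (ZMod 2) k) ∈ I')
    (P : Finset (Fin k × (Fin n → ZMod 2))) (hP : P.card = N + 1) : Interp I f P := by
  classical
  by_contra hcon
  let t : P → ZMod 2 := fun x => f x.1.1 x.1.2
  have hcancel : ∀ a (x : P), a + t x + t x = a := by
    intro a x; rw [add_assoc, zmod2_add_self, add_zero]
  -- Members of `I` acting on `P`-tuples, conjugated by the translation that moves the values of `f`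
  -- to zero.
  let J : ∀ m : ℕ, Set (P → (Fin m → ZMod 2) → ZMod 2) := fun m =>
    {j | ∃ (h : 0 < m) (g : Op (ZMod 2) k m), (⟨⟨m, h⟩, g⟩ : KOp (ZMod 2) k) ∈ I ∧
      j = fun x a => g x.1.1 (fun l => a l + t x) + t x}
  have hJ : Idem J := by
    rintro m j ⟨hm, g, hg, rfl⟩ x b
    exact (congrArg (· + t x) (hidem ⟨m, hm⟩ g hg x.1.1 (b + t x))).trans (hcancel b x)
  let S : Set (P → ZMod 2) := {c | ∃ g : Op (ZMod 2) k n, (⟨n, g⟩ : KOp (ZMod 2) k) ∈ I ∧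
    ∀ x : P, c x = g x.1.1 x.1.2 + t x}
  have hS : InvUnder J S := by
    rintro m j ⟨hm, h, hh, rfl⟩ c hc
    choose g hg hgc using hc
    refine ⟨comp h g, hI.comp_mem ⟨m, hm⟩ n h g hh hg, ?_⟩
    intro x
    simp only [applyAt, comp, hgc, hcancel]
  have h0S : (0 : P → ZMod 2) ∉ S := by
    rintro ⟨g, hg, hgf⟩
    refine hcon ⟨g, hg, fun p hp => ?_⟩
    have := hgf ⟨p, hp⟩
    simp only [Pi.zero_apply] at this
    have h2 := hcancel (g p.1 p.2) ⟨p, hp⟩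
    rw [← this, zero_add] at h2
    exact h2.symm
  obtain ⟨R, hSR, hR⟩ := exists_maxAvoid J S hS h0S
  have hsing : ∀ i, ind {i} ∈ R := by
    intro i
    obtain ⟨g, hg, hgf⟩ := ih n f hf (P.erase i.1) (by
      rw [Finset.card_erase_of_mem i.2, hP]; omega)
    apply hSR
    refine ⟨g, hg, ?_⟩
    intro x
    by_cases hx : x = i
    · subst hx
      have hne : g x.1.1 x.1.2 + t x ≠ 0 := by
        intro h0
        refine hcon ⟨g, hg, fun p hp => ?_⟩
        by_cases hpx : p = x.1
        · subst hpx
          have h2 := hcancel (g x.1.1 x.1.2) x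
          rw [h0, zero_add] at h2
          exact h2.symm
        · exact hgf p (Finset.mem_erase.2 ⟨hpx, hp⟩)
      rw [zmod2_ne_zero.1 hne]; simp [ind]
    · have : g x.1.1 x.1.2 = t x :=
        hgf x.1 (Finset.mem_erase.2 ⟨fun h => hx (Subtype.ext h), x.2⟩)
      rw [this, zmod2_add_self]; simp [ind, hx]
  let F : P → (Fin n → ZMod 2) → ZMod 2 := fun x a => f x.1.1 (fun l => a l + t x) + t x
  have hF : ∀ x b, F x (fun _ => b) = b := by
    intro x b
    exact (congrArg (· + t x) (hidem' n f hf x.1.1 (b + t x))).trans (hcancel b x)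
  have hH : ∀ p, ∀ c : Fin n → P → ZMod 2, (∀ l, c l ∈ R) → (∀ l, c l p = 0) →
      applyAt F c ∈ R := by
    intro p c hc hcp
    -- At `p` all inputs vanish and idempotence suffices, so only `N` points need interpolation.
    obtain ⟨g, hg, hgf⟩ := ih n f hf
      ((Finset.univ.erase p).image (fun x : P => (x.1.1, fun l => c l x + t x))) (by
        refine Finset.card_image_le.trans ?_
        rw [Finset.card_erase_of_mem (Finset.mem_univ _), Finset.card_univ, Fintype.card_coe, hP]
        omega)
    have hj : (fun (x : P) (a : Fin n → ZMod 2) => g x.1.1 (fun l => a l + t x) + t x) ∈ J n :=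
      ⟨n.pos, g, hg, rfl⟩
    have := hR.inv n _ hj c hc
    convert this using 1
    funext x
    by_cases hx : x = p
    · subst hx
      have h1 : (fun l => c l x) = fun _ => 0 := funext hcp
      exact ((congrArg (F x) h1).trans (hF x 0)).trans
        ((congrArg (fun a : Fin n → ZMod 2 => g x.1.1 (fun l => a l + t x) + t x) h1).trans
          (hJ n _ hj x 0)).symm
    · simp only [applyAt, F]
      rw [← hgf (x.1.1, fun l => c l x + t x)
        (Finset.mem_image.2 ⟨x, by simp [hx], rfl⟩)]
  let c : Fin n → P → ZMod 2 := fun l x => x.1.2 l + t x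
  have hc : ∀ l, c l ∈ R := fun l =>
    hSR ⟨proj _ k n l, hI.proj_mem n l, fun x => rfl⟩
  have hfc : applyAt F c = 0 := by
    funext x
    simp only [applyAt, F, c, hcancel]
    exact zmod2_add_self _
  obtain ⟨W, hW, hWcases⟩ := hR.exists_eq_compl hJ hsing
  have hpq : ∀ i j : P, ∃ p q : P, p ≠ i ∧ p ≠ j ∧ q ≠ i ∧ q ≠ j ∧ p ≠ q := by
    intro i j
    have hcard : 1 < ((Finset.univ.erase i).erase j).card := by
      have h1 : (Finset.univ.erase i).card = N := by
        rw [Finset.card_erase_of_mem (Finset.mem_univ _), Finset.card_univ, Fintype.card_coe, hP]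
        omega
      have := Finset.pred_card_le_card_erase (s := Finset.univ.erase i) (a := j)
      omega
    obtain ⟨p, hp, q, hq, hne⟩ := Finset.one_lt_card.1 hcard
    simp only [Finset.mem_erase, Finset.mem_univ, and_true] at hp hq
    exact ⟨p, q, hp.2, hp.1, hq.2, hq.1, hne⟩
  have hcontra : ∀ i j : P, i ≠ j →
      (ind {i, j} ∈ W ∨ (W = ⊥ ∧ ∀ w, F j w = F i (fun s => w s + 1) + 1)) → False := by
    intro i j hij hedge
    obtain ⟨p, q, hpi, hpj, hqi, hqj, hne⟩ := hpq i j
    exact resolution_contra W hW hsing F (fun x => hF x 0) hH hij hpi hpj hqi hqj hne hedge c hc hfc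
  rcases hWcases with hbot | ⟨i, j, hij, hZ⟩
  swap
  · exact hcontra i j hij (Or.inl hZ)
  -- Two points of one sort with different wanted values carry dual translates of the same component
  -- of `f`, which is the second alternative of resolution.
  have hpure : ∀ i j : P, i.1.1 = j.1.1 → t i = t j := by
    intro i j hs
    by_contra hne
    have hij : i ≠ j := by rintro rfl; exact hne rfl
    refine hcontra i j hij (Or.inr ⟨hbot, fun w => ?_⟩)
    have htj : t j = t i + 1 := by
      revert hne
      generalize t i = a
      generalize t j = b
      revert a b; decide
    simp only [F, hs, htj]
    have : (fun l => w l + (t i + 1)) = fun l => w l + 1 + t i := by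
      funext l; rw [add_assoc, add_comm 1]
    rw [this, add_assoc]
  have hb : ∀ s : Fin k, ∃ b : ZMod 2, ∀ x : P, x.1.1 = s → t x = b := by
    intro s
    by_cases h : ∃ x : P, x.1.1 = s
    · obtain ⟨x, hx⟩ := h
      exact ⟨t x, fun y hy => hpure y x (hy.trans hx.symm)⟩
    · exact ⟨0, fun x hx => (h ⟨x, hx⟩).elim⟩
  choose b hb using hb
  let A : Fin k → Finset P := fun s => Finset.univ.filter (fun x => x.1.1 = s)
  have hmem : (fun s => (A s).card) ∈ clauseSet I b := by
    intro m g hg X hX hgX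
    -- Surplus points of sort `s` receive the constant tuple `b s`, which idempotence also sends to
    -- `b s`.
    choose φ hφ hφ' using fun s => exists_cover (A s) (X s) (hX s) (fun _ => b s)
    let d : Fin m → P → ZMod 2 := fun l x => φ x.1.1 x l + t x
    by_contra hno
    push Not at hno
    have hd : ∀ l, d l ∈ R := by
      intro l
      rw [hW, hbot, AddSubgroup.mem_bot]
      intro h0
      obtain ⟨s, r, hr, hrl⟩ := hno l
      obtain ⟨x, hx, rfl⟩ := hφ s r hr
      have hxs : x.1.1 = s := by simpa [A] using hx
      apply hrl
      have h1 := congrFun h0 x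
      simp only [d, Pi.zero_apply, hxs] at h1
      have h2 := hcancel (φ s x l) x
      rw [h1, zero_add] at h2
      rw [← h2, hb s x hxs]
    have hj : (fun (x : P) (a : Fin m → ZMod 2) => g x.1.1 (fun l => a l + t x) + t x) ∈ J m :=
      ⟨m.pos, g, hg, rfl⟩
    apply hR.zero
    convert hR.inv m _ hj d hd using 1
    funext x
    simp only [applyAt, d, hcancel, Pi.zero_apply]
    have : g x.1.1 (φ x.1.1 x) = b x.1.1 := by
      rcases hφ' x.1.1 x with h | h
      · exact hgX _ _ h
      · rw [h]; exact hidem m g hg _ _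
    rw [show (fun l => φ x.1.1 x l) = φ x.1.1 x from rfl, this, hb _ x rfl, zmod2_add_self]
  obtain ⟨l, hl⟩ := hclause b hmem n f hf (fun s => (A s).image (fun x => x.1.2))
    (fun s => Finset.card_image_le) (by
      intro s r hr
      obtain ⟨x, hx, rfl⟩ := Finset.mem_image.1 hr
      have hxs : x.1.1 = s := by simpa [A] using hx
      rw [← hb s x hxs, ← hxs])
  apply hR.zero
  convert hc l using 1
  funext x
  have := hl x.1.1 x.1.2 (Finset.mem_image.2 ⟨x, by simp [A], rfl⟩)
  simp only [c, Pi.zero_apply, this, hb _ x rfl, zmod2_add_self]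

/-- A clone of idempotent operations is determined by its invariant ternary relations and its
invariant clauses. -/
theorem idempotent_clone_le {I I' : Set (KOp (ZMod 2) k)} (hI : IsClone I) (hidem : IsIdem I)
    (hidem' : IsIdem I') (hthree : ∀ σ R, PresThree I σ R → PresThree I' σ R)
    (hclause : ∀ b, clauseSet I b ≤ clauseSet I' b) : I' ⊆ I := by
  have hall : ∀ (N : ℕ) (n : ℕ+) (f : Op (ZMod 2) k n), (⟨n, f⟩ : KOp (ZMod 2) k) ∈ I' →
      ∀ P : Finset (Fin k × (Fin n → ZMod 2)), P.card ≤ N + 3 → Interp I f P := by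
    intro N
    induction N with
    | zero => exact fun n f hf P hP => interp_of_card_le_three hI hthree hf P hP
    | succ N ih =>
      intro n f hf P hP
      rcases Nat.lt_or_ge P.card (N + 1 + 3) with h | h
      · exact ih n f hf P (by omega)
      · exact interp_succ hI hidem hidem' hclause (N := N + 3) (by omega) ih hf P (by omega)
  rintro ⟨n, f⟩ hf
  obtain ⟨g, hg, hgf⟩ := hall _ n f hf Finset.univ (Nat.le_add_right _ 3)
  have : g = f := by
    funext s r
    exact hgf (s, r) (Finset.mem_univ _)
  rwa [← this]

end Idempotent

end MultiSorted
namespace MultiSorted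

/-! ### Reduction to idempotent operations -/

section Reduction

variable {k : ℕ}

/-- The term operation `D` in variables indexed by `X` can be evaluated inside `C`. -/
def Acts (C : Set (KOp (ZMod 2) k)) {X : Type} (D : Fin k → (X → ZMod 2) → ZMod 2) : Prop :=
  ∀ (n : ℕ+) (g : X → Op (ZMod 2) k n), (∀ x, (⟨n, g x⟩ : KOp (ZMod 2) k) ∈ C) →
    (⟨n, fun i z => D i (fun x => g x i z)⟩ : KOp (ZMod 2) k) ∈ C

theorem acts_var (C : Set (KOp (ZMod 2) k)) {X : Type} (x : X) : Acts C (fun _ z => z x) :=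
  fun _ _ hg => hg x

theorem Acts.subst {C : Set (KOp (ZMod 2) k)} {X Y : Type} {D : Fin k → (X → ZMod 2) → ZMod 2}
    (hD : Acts C D) {E : X → Fin k → (Y → ZMod 2) → ZMod 2} (hE : ∀ x, Acts C (E x)) :
    Acts C (fun i y => D i (fun x => E x i y)) :=
  fun n g hg => hD n (fun x i z => E x i (fun y => g y i z)) (fun x => hE x n g hg)

theorem IsClone.acts {C : Set (KOp (ZMod 2) k)} (hC : IsClone C) {n : ℕ+} {f : Op (ZMod 2) k n}
    (hf : (⟨n, f⟩ : KOp (ZMod 2) k) ∈ C) : Acts C f :=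
  fun m g hg => hC.comp_mem n m f g hf hg

theorem IsClone.mem_of_acts {C : Set (KOp (ZMod 2) k)} (hC : IsClone C) {n : ℕ+}
    {f : Op (ZMod 2) k n} (hf : Acts C f) : (⟨n, f⟩ : KOp (ZMod 2) k) ∈ C :=
  hf n (fun j => proj _ k n j) (fun j => hC.proj_mem n j)

/-- The unary members of `C`. -/
def unary (C : Set (KOp (ZMod 2) k)) : Set (Fin k → ZMod 2 → ZMod 2) :=
  {u | (⟨1, fun i x => u i (x 0)⟩ : KOp (ZMod 2) k) ∈ C}

theorem acts_unary {C : Set (KOp (ZMod 2) k)} (hC : IsClone C) {u : Fin k → ZMod 2 → ZMod 2}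
    (hu : u ∈ unary C) {X : Type} {E : Fin k → (X → ZMod 2) → ZMod 2} (hE : Acts C E) :
    Acts C (fun i x => u i (E i x)) :=
  (hC.acts hu).subst (E := fun _ => E) (fun _ => hE)

theorem id_mem_unary {C : Set (KOp (ZMod 2) k)} (hC : IsClone C) : (fun _ b => b) ∈ unary C :=
  hC.proj_mem 1 0

theorem comp_mem_unary {C : Set (KOp (ZMod 2) k)} (hC : IsClone C) {n : ℕ+} {f : Op (ZMod 2) k n}
    (hf : (⟨n, f⟩ : KOp (ZMod 2) k) ∈ C) {v : Fin n → Fin k → ZMod 2 → ZMod 2}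
    (hv : ∀ l, v l ∈ unary C) : (fun i b => f i (fun l => v l i b)) ∈ unary C :=
  hC.acts hf 1 (fun l i x => v l i (x 0)) hv

theorem zmod2_involutive (h : ZMod 2 → ZMod 2) (hne : h 0 ≠ h 1) (b : ZMod 2) : h (h b) = b := by
  revert h b; decide

theorem zmod2_const (h : ZMod 2 → ZMod 2) (he : h 0 = h 1) (a b : ZMod 2) : h a = h b := by
  revert h a b; decide

/-- An operation without constant components becomes bijective in all components after a suitable
substitution of unary operations. -/
theorem exists_bijective_subst {n : ℕ} (f : Op (ZMod 2) k n)
    (hf : ∀ i, ∃ a b, f i a ≠ f i b) (V : Set (Fin k → ZMod 2 → ZMod 2))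
    (hid : (fun _ b => b) ∈ V) (hcomp : ∀ u ∈ V, ∀ v ∈ V, (fun i b => u i (v i b)) ∈ V)
    (hfV : ∀ v : Fin n → Fin k → ZMod 2 → ZMod 2, (∀ l, v l ∈ V) →
      (fun i b => f i (fun l => v l i b)) ∈ V) :
    ∃ v : Fin n → Fin k → ZMod 2 → ZMod 2, (∀ l, v l ∈ V) ∧
      ∀ i, f i (fun l => v l i 0) ≠ f i (fun l => v l i 1) := by
  classical
  suffices h : ∀ T : Finset (Fin k), ∃ v : Fin n → Fin k → ZMod 2 → ZMod 2, (∀ l, v l ∈ V) ∧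
      ∀ i ∈ T, f i (fun l => v l i 0) ≠ f i (fun l => v l i 1) by
    obtain ⟨v, hv, h⟩ := h Finset.univ
    exact ⟨v, hv, fun i => h i (Finset.mem_univ i)⟩
  intro T
  induction T using Finset.strongInduction with
  | H T ih =>
    by_contra hcon
    push Not at hcon
    -- for each sort, a unary operation which is constant at this sort and the identity at the others
    have hw : ∀ i ∈ T, ∃ w ∈ V, ∃ c, (∀ b, w i b = c) ∧ ∀ j ∈ T, j ≠ i → ∀ b, w j b = b := by
      intro i hi
      obtain ⟨v, hv, hvT⟩ := ih (T.erase i) (Finset.erase_ssubset hi)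
      obtain ⟨j, hj, hjv⟩ := hcon v hv
      have hji : j = i := by
        by_contra hne
        exact hvT j (Finset.mem_erase.2 ⟨hne, hj⟩) hjv
      subst hji
      -- This is constant at `j` and a permutation at the other sorts of `T`, so its square is
      -- constant at `j` and the identity at those.
      let w : Fin k → ZMod 2 → ZMod 2 := fun i b => f i (fun l => v l i b)
      have hwV : w ∈ V := hfV v hv
      refine ⟨_, hcomp w hwV w hwV, w j (w j 0), ?_, ?_⟩
      · intro b
        exact congrArg (w j) (zmod2_const (w j) hjv b 0)
      · intro i hi hne b
        exact zmod2_involutive (w i) (hvT i (Finset.mem_erase.2 ⟨hne, hi⟩)) b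
    choose! w hwV c hwc hwid using hw
    have hD : ∀ D : Finset (Fin k), D ⊆ T → ∃ u ∈ V, (∀ j ∈ T, j ∉ D → ∀ b, u j b = b) ∧
        ∀ j ∈ D, ∀ b, u j b = c j := by
      intro D
      induction D using Finset.induction_on with
      | empty => exact fun _ => ⟨_, hid, fun _ _ _ _ => rfl, by simp⟩
      | insert i D hiD ihD =>
        intro hDT
        have hiT : i ∈ T := hDT (Finset.mem_insert_self _ _)
        obtain ⟨u, hu, hu1, hu2⟩ := ihD ((Finset.subset_insert _ _).trans hDT)
        refine ⟨_, hcomp (w i) (hwV i hiT) u hu, ?_, ?_⟩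
        · intro j hj hjD b
          rw [Finset.mem_insert, not_or] at hjD
          rw [hu1 j hj hjD.2, hwid i hiT j hj hjD.1]
        · intro j hj b
          rcases Finset.mem_insert.1 hj with rfl | hjD
          · exact hwc j hiT _
          · rw [hu2 j hjD, hwid i hiT j (hDT hj) (by rintro rfl; exact hiD hjD)]
    have ha : ∀ i, ∃ a, f i a ≠ f i (fun _ => c i) := by
      intro i
      obtain ⟨a, b, hab⟩ := hf i
      by_cases h : f i a = f i (fun _ => c i)
      · exact ⟨b, fun h' => hab (h.trans h'.symm)⟩
      · exact ⟨a, h⟩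
    choose a ha using ha
    -- Position `l` freezes the sorts with `a i l = c i`; replacing `c j` by `c j + 1` then moves
    -- the arguments of `f j` from the constant tuple `c j` to `a j`.
    choose v hvV hv1 hv2 using fun l : Fin n => hD (T.filter (fun i => a i l = c i))
      (Finset.filter_subset _ _)
    obtain ⟨j, hj, hjv⟩ := hcon v hvV
    have hconst := zmod2_const (fun b => f j (fun l => v l j b)) hjv (c j) (c j + 1)
    have h1 : (fun l => v l j (c j)) = fun _ => c j := by
      funext l
      by_cases h : a j l = c j
      · exact hv2 l j (by simp [hj, h]) _
      · exact hv1 l j hj (by simp [h]) _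
    have h2 : (fun l => v l j (c j + 1)) = a j := by
      funext l
      by_cases h : a j l = c j
      · rw [hv2 l j (by simp [hj, h]), h]
      · rw [hv1 l j hj (by simp [h])]
        revert h
        generalize a j l = x
        generalize c j = y
        revert x y; decide
    rw [h1, h2] at hconst
    exact ha j hconst.symm

/-- The idempotent members of `C`. -/
def idemPart (C : Set (KOp (ZMod 2) k)) : Set (KOp (ZMod 2) k) :=
  {f | f ∈ C ∧ ∀ i b, f.2 i (fun _ => b) = b}

theorem isIdem_idemPart (C : Set (KOp (ZMod 2) k)) : IsIdem (idemPart C) :=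
  fun _ _ hf => hf.2

theorem IsClone.idemPart {C : Set (KOp (ZMod 2) k)} (hC : IsClone C) : IsClone (idemPart C) where
  proj_mem n i := ⟨hC.proj_mem n i, fun _ _ => rfl⟩
  comp_mem m n f g hf hg := by
    refine ⟨hC.comp_mem m n f g hf.1 (fun j => (hg j).1), fun i b => ?_⟩
    have : (fun j => g j i (fun _ => b)) = fun _ => b := funext fun j => (hg j).2 i b
    simp only [comp, this]
    exact hf.2 i b

theorem acts_of_idempotent {C C' : Set (KOp (ZMod 2) k)} (hC : IsClone C) (hC' : IsClone C')
    (hidem : idemPart C' ⊆ C) {X : Type} [Fintype X] [Nonempty X]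
    {F : Fin k → (X → ZMod 2) → ZMod 2} (hF : Acts C' F) (hFid : ∀ i b, F i (fun _ => b) = b) :
    Acts C F := by
  let N : ℕ+ := ⟨Fintype.card X, Fintype.card_pos⟩
  let e : X ≃ Fin N := Fintype.equivFin X
  have hmem : (⟨N, fun i z => F i (fun x => z (e x))⟩ : KOp (ZMod 2) k) ∈ C :=
    hidem ⟨hF N (fun x => proj _ k N (e x)) (fun x => hC'.proj_mem N _), fun i b => hFid i b⟩
  intro n g hg
  have := hC.acts hmem n (fun j => g (e.symm j)) (fun j => hg _)
  simpa using this

/-- Substitutions of unary members of `C` turn `D` into a projection, and the diagonal of `D` is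
`v`. -/
structure IsGood (C : Set (KOp (ZMod 2) k)) (v : Fin k → ZMod 2 → ZMod 2)
    (D : Fin k → (unary C → ZMod 2) → ZMod 2) : Prop where
  acts : Acts C D
  diag : ∀ i b, D i (fun _ => b) = v i b
  spec : ∀ i b, D i (fun u => u.1 i b) = b

/-- A clone is contained in another one if this holds for its unary, its idempotent members and for
the members with a constant component. -/
theorem clone_le_of_idempotent {C C' : Set (KOp (ZMod 2) k)} (hC : IsClone C) (hC' : IsClone C')
    (hunary : unary C' ⊆ unary C) (hidem : idemPart C' ⊆ C)
    (hconst : ∀ (n : ℕ+) (f : Op (ZMod 2) k n), (⟨n, f⟩ : KOp (ZMod 2) k) ∈ C' →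
      ∀ i c, (∀ x, f i x = c) → (⟨n, f⟩ : KOp (ZMod 2) k) ∈ C) : C' ⊆ C := by
  classical
  rintro ⟨n, f⟩ hf
  by_cases hfc : ∃ i, ∀ a b, f i a = f i b
  · obtain ⟨i, hi⟩ := hfc
    exact hconst n f hf i (f i 0) (fun x => hi x 0)
  push Not at hfc
  have hact := hC'.acts hf
  have hucomp : ∀ u ∈ unary C', ∀ v ∈ unary C', (fun i b => u i (v i b)) ∈ unary C' :=
    fun u hu v hv => comp_mem_unary hC' (f := fun i x => u i (x 0)) hu (v := fun _ => v)
      (fun _ => hv)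
  obtain ⟨v₀, hv₀, hg₀⟩ := exists_bijective_subst f hfc (unary C') (id_mem_unary hC') hucomp
    (fun v hv => comp_mem_unary hC' hf hv)
  let g₀ : Fin k → ZMod 2 → ZMod 2 := fun i b => f i (fun l => v₀ l i b)
  have hg₀mem : g₀ ∈ unary C' := comp_mem_unary hC' hf hv₀
  have hg₀inv : ∀ i b, g₀ i (g₀ i b) = b := fun i b => zmod2_involutive (g₀ i) (hg₀ i) b
  -- Now the substitutions are restricted to diagonals of terms that return `b` when fed all `u b`,
  -- so that they can be undone.
  obtain ⟨v, hv, hg⟩ := exists_bijective_subst f hfc {v | ∃ D, IsGood C' v D}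
    ⟨fun i x => x ⟨_, id_mem_unary hC'⟩, acts_var C' _, fun _ _ => rfl, fun _ _ => rfl⟩
    (by
      rintro u ⟨D, hD⟩ v ⟨E, hE⟩
      refine ⟨fun i x => D i (fun w => E i (fun w' => x ⟨_, hucomp _ w'.2 _ w.2⟩)), ?_, ?_, ?_⟩
      · exact hD.acts.subst fun w => hE.acts.subst fun w' => acts_var C' _
      · intro i b
        simp only [hE.diag, hD.diag]
      · intro i b
        simp only [hE.spec i, hD.spec i])
    (by
      intro v hv
      choose D hD using hv
      -- After the shift of indices, `D l` returns `v₀ l (g₀ b)`, so `f` returns `g₀ (g₀ b) = b`.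
      refine ⟨fun i x => f i (fun l => D l i (fun w =>
        x ⟨_, hucomp _ w.2 _ (hucomp _ (hv₀ l) _ hg₀mem)⟩)), ?_, ?_, ?_⟩
      · exact hact.subst fun l => (hD l).acts.subst fun w => acts_var C' _
      · intro i b
        simp only [(hD _).diag]
      · intro i b
        simp only [(hD _).spec i]
        exact hg₀inv i b)
  choose D hD using hv
  let g : Fin k → ZMod 2 → ZMod 2 := fun i b => f i (fun l => v l i b)
  have hginv : ∀ i b, g i (g i b) = b := fun i b => zmod2_involutive (g i) (hg i) b
  have hgmem : g ∈ unary C' := by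
    have hE : Acts C' (fun i (x : Unit → ZMod 2) => f i (fun l => D l i (fun _ => x ()))) :=
      hact.subst fun l => (hD l).acts.subst fun _ => acts_var C' ()
    have := hE 1 (fun _ i x => x 0) (fun _ => hC'.proj_mem 1 0)
    simp only [(hD _).diag] at this
    exact this
  -- On the diagonal `F` is `g ∘ g`, the identity, so it is idempotent; substituting `w (x l)` for
  -- the variable `(l, w)` turns it into `g ∘ f`.
  let F : Fin k → (Fin n × unary C' → ZMod 2) → ZMod 2 := fun i x =>
    g i (f i (fun l => D l i (fun w => x (l, w))))
  have hF' : Acts C' F :=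
    acts_unary hC' hgmem (hact.subst fun l => (hD l).acts.subst fun w => acts_var C' _)
  have : Nonempty (Fin n × unary C') := ⟨⟨0, n.pos⟩, ⟨_, id_mem_unary hC'⟩⟩
  have hF : Acts C F := acts_of_idempotent hC hC' hidem hF' (by
    intro i b
    simp only [F, (hD _).diag]
    exact hginv i b)
  apply hC.mem_of_acts
  have hsub : Acts C (fun i (x : Fin n → ZMod 2) => g i (F i (fun p => p.2.1 i (x p.1)))) :=
    acts_unary hC (hunary hgmem) (hF.subst fun p =>
      acts_unary hC (hunary p.2.2) (acts_var C p.1))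
  convert hsub using 1
  funext i x
  simp only [F, (hD _).spec i, hginv]

end Reduction

end MultiSorted
namespace MultiSorted

/-! ### Members with a constant component -/

section ConstPart

variable {m : ℕ}

/-- The members of `C` whose component of sort `s` is constantly `c`, with this component left
out. -/
def constPart (C : Set (KOp (ZMod 2) (m + 1))) (s : Fin (m + 1)) (c : ZMod 2) :
    Set (KOp (ZMod 2) m) :=
  {f | ∃ g : Op (ZMod 2) (m + 1) f.1, (⟨f.1, g⟩ : KOp (ZMod 2) (m + 1)) ∈ C ∧
    (∀ x, g s x = c) ∧ ∀ i, g (s.succAbove i) = f.2 i}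

/-- The set of all projections. -/
def projSet (k : ℕ) : Set (KOp (ZMod 2) k) := {f | ∃ i, f.2 = proj (ZMod 2) k f.1 i}

theorem isClone_constPart_union {C : Set (KOp (ZMod 2) (m + 1))} (hC : IsClone C)
    (s : Fin (m + 1)) (c : ZMod 2) : IsClone (constPart C s c ∪ projSet m) where
  proj_mem n i := Or.inr ⟨i, rfl⟩
  comp_mem p n f g hf hg := by
    rcases hf with ⟨f', hf', hfs, hff⟩ | ⟨i, hi⟩
    · have hlift : ∀ j, ∃ g' : Op (ZMod 2) (m + 1) n,
          (⟨n, g'⟩ : KOp (ZMod 2) (m + 1)) ∈ C ∧ ∀ i, g' (s.succAbove i) = g j i := by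
        intro j
        rcases hg j with ⟨g', hg', -, h⟩ | ⟨i, hi⟩
        · exact ⟨g', hg', h⟩
        · exact ⟨proj _ _ n i, hC.proj_mem n i, fun _ => by rw [show g j = _ from hi]; rfl⟩
      choose g' hg' hgg using hlift
      refine Or.inl ⟨comp f' g', hC.comp_mem p n f' g' hf' hg', fun x => hfs _, fun i => ?_⟩
      funext x
      simp only [comp, hgg, hff]
    · have : comp f g = g i := by
        rw [show f = _ from hi]; rfl
      rw [this]
      exact hg i

/-- Adjoining the projections loses just one bit: identifying all variables of one projection in the
constant part gives every other projection. -/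
theorem constPart_subset {C C' : Set (KOp (ZMod 2) (m + 1))} (hC : IsClone C) {s : Fin (m + 1)}
    {c : ZMod 2} (h : constPart C' s c ⊆ constPart C s c ∪ projSet m)
    (hflag : (constPart C' s c ∩ projSet m).Nonempty → (constPart C s c ∩ projSet m).Nonempty) :
    constPart C' s c ⊆ constPart C s c := by
  rintro ⟨n, f⟩ hf
  rcases h hf with hf' | ⟨i, hi⟩
  · exact hf'
  obtain ⟨⟨p, f'⟩, ⟨g, hg, hgs, hgj⟩, j, hj⟩ := hflag ⟨_, hf, i, hi⟩
  refine ⟨comp g (fun _ => proj _ _ n i), hC.comp_mem p n g _ hg (fun _ => hC.proj_mem n i),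
    fun x => hgs _, fun l => ?_⟩
  funext x
  have hj' : f' = proj _ _ p j := hj
  have hi' : f = proj _ _ n i := hi
  simp only [comp, hgj, hj', hi']
  rfl

theorem mem_of_constPart_subset {C C' : Set (KOp (ZMod 2) (m + 1))} {s : Fin (m + 1)} {c : ZMod 2}
    (h : constPart C' s c ⊆ constPart C s c) {n : ℕ+} {f : Op (ZMod 2) (m + 1) n}
    (hf : (⟨n, f⟩ : KOp (ZMod 2) (m + 1)) ∈ C') (hfs : ∀ x, f s x = c) :
    (⟨n, f⟩ : KOp (ZMod 2) (m + 1)) ∈ C := by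
  obtain ⟨g, hg, hgs, hgf⟩ := h (show (⟨n, fun i => f (s.succAbove i)⟩ : KOp (ZMod 2) m) ∈ _ from
    ⟨f, hf, hfs, fun _ => rfl⟩)
  have : g = f := by
    funext i
    refine (Fin.forall_iff_succAbove (P := fun i => g i = f i) s).2 ⟨?_, hgf⟩ i
    funext x
    rw [hgs, hfs]
  rwa [← this]

theorem constPart_mono {C C' : Set (KOp (ZMod 2) (m + 1))} (h : C ⊆ C') (s : Fin (m + 1))
    (c : ZMod 2) : constPart C s c ⊆ constPart C' s c :=
  fun _ ⟨g, hg, hgs, hgf⟩ => ⟨g, h hg, hgs, hgf⟩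

end ConstPart

/-! ### Finite families of downsets as a single downset -/

section Pack

variable {T : Type} [Finite T] {k : ℕ}

/-- A finite family of downsets of `ℕ ^ k`, placed above the members of an antichain in two further
coordinates. -/
noncomputable def pack (hk : 2 ≤ k) (D : T → LowerSet (Fin k → ℕ)) :
    LowerSet (Fin (2 * k) → ℕ) where
  carrier := {p | ∃ t, p ⟨k, by omega⟩ ≤ (Finite.equivFin T t : ℕ) ∧
    p ⟨k + 1, by omega⟩ ≤ Nat.card T - (Finite.equivFin T t : ℕ) ∧
    (p ⟨k, by omega⟩ = (Finite.equivFin T t : ℕ) →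
      p ⟨k + 1, by omega⟩ = Nat.card T - (Finite.equivFin T t : ℕ) →
      (fun i : Fin k => p ⟨i, by omega⟩) ∈ D t)}
  lower' := by
    rintro p q hqp ⟨t, h1, h2, h3⟩
    refine ⟨t, (hqp _).trans h1, (hqp _).trans h2, fun h4 h5 => ?_⟩
    refine (D t).lower (fun i => hqp _) (h3 ?_ ?_)
    · exact le_antisymm h1 (h4.symm.le.trans (hqp _))
    · exact le_antisymm h2 (h5.symm.le.trans (hqp _))

theorem pack_mono (hk : 2 ≤ k) {D D' : T → LowerSet (Fin k → ℕ)} (h : D ≤ D') :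
    pack hk D ≤ pack hk D' :=
  fun _ ⟨t, h1, h2, h3⟩ => ⟨t, h1, h2, fun h4 h5 => h t (h3 h4 h5)⟩

theorem pack_injective (hk : 2 ≤ k) :
    Function.Injective (pack hk : (T → LowerSet (Fin k → ℕ)) → LowerSet (Fin (2 * k) → ℕ)) := by
  -- With `t` numbered in `T`, the points `(t, |T| - t)` form an antichain, so a probe whose two
  -- further coordinates are this point sees only `D t`.
  have key : ∀ (D : T → LowerSet (Fin k → ℕ)) (t : T) (x : Fin k → ℕ),
      (fun i : Fin (2 * k) => if h : (i : ℕ) < k then x ⟨i, h⟩ else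
        if (i : ℕ) = k then (Finite.equivFin T t : ℕ) else Nat.card T - (Finite.equivFin T t : ℕ))
        ∈ pack hk D ↔ x ∈ D t := by
    intro D t x
    constructor
    · rintro ⟨t', h1, h2, h3⟩
      have hlt := (Finite.equivFin T t).2
      have hlt' := (Finite.equivFin T t').2
      simp only [lt_irrefl, dite_false, if_true, Nat.not_succ_lt_self, Nat.succ_ne_self,
        if_false] at h1 h2 h3
      have heq : (Finite.equivFin T t : ℕ) = Finite.equivFin T t' := by omega
      have htt : t = t' := (Finite.equivFin T).injective (Fin.ext heq)
      subst htt
      simpa using h3 rfl rfl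
    · intro hx
      exact ⟨t, by simp, by simp, fun _ _ => by simpa using hx⟩
  intro D D' h
  funext t
  ext x
  show x ∈ D t ↔ x ∈ D' t
  rw [← key D t x, ← key D' t x, h]

end Pack

/-! ### The embedding -/

section Embedding

variable {k : ℕ}

/-- The sorted relation `ρ` is invariant under `C`. -/
def Invariant (C : Set (KOp (ZMod 2) k)) (ρ : SortedRel k) : Prop :=
  ∀ (n : ℕ+) (f : Op (ZMod 2) k n), (⟨n, f⟩ : KOp (ZMod 2) k) ∈ C →
    ∀ c : Fin n → Fin ρ.arity → ZMod 2, (∀ l, c l ∈ ρ.rel) →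
      (fun x => f (ρ.sort x) (fun l => c l x)) ∈ ρ.rel

/-- The downset which is everything if `p` holds, and empty otherwise. -/
def constLower (k : ℕ) (p : Prop) : LowerSet (Fin k → ℕ) := ⟨{_v | p}, fun _ _ _ h => h⟩

theorem constLower_mono {p q : Prop} (h : p → q) : constLower k p ≤ constLower k q :=
  fun _ hp => h hp

theorem of_constLower_eq {p q : Prop} (h : constLower k p = constLower k q) (hp : p) : q :=
  (h ▸ (show (0 : Fin k → ℕ) ∈ constLower k p from hp) : (0 : Fin k → ℕ) ∈ constLower k q)

/-- The index set of the downsets attached to a clone. -/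
abbrev DownsetIndex (k : ℕ) : Type :=
  (Fin k → ZMod 2) ⊕ ((Fin 3 → Fin k) × Set (Fin 3 → ZMod 2)) ⊕ (Fin k → ZMod 2 → ZMod 2)

/-- The invariant clauses and ternary relations of the idempotent part of `C`, and the unary
operations missing in `C`. -/
def downsets (C : Set (KOp (ZMod 2) k)) : DownsetIndex k → LowerSet (Fin k → ℕ)
  | .inl b => clauseSet (idemPart C) b
  | .inr (.inl φ) => constLower k (PresThree (idemPart C) φ.1 φ.2)
  | .inr (.inr u) => constLower k (u ∉ unary C)

theorem downsets_antitone {C C' : Set (KOp (ZMod 2) k)} (h : C ⊆ C') :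
    downsets C' ≤ downsets C := by
  have hid : idemPart C ⊆ idemPart C' := fun f hf => ⟨h hf.1, hf.2⟩
  rintro (b | φ | u)
  · exact fun v hv n f hf => hv n f (hid hf)
  · exact constLower_mono fun hφ n f hf => hφ n f (hid hf)
  · exact constLower_mono fun hu hu' => hu (h hu')

/-! ### Recovering a clone from the attached data -/

theorem idemPart_subset_of_downsets_eq {C C' : Set (KOp (ZMod 2) k)} (hC : IsClone C)
    (h : downsets C = downsets C') : idemPart C' ⊆ C := by
  have hle := idempotent_clone_le hC.idemPart (isIdem_idemPart C) (isIdem_idemPart C')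
    (fun σ R => of_constLower_eq (congrFun h (.inr (.inl (σ, R)))))
    (fun b => (congrFun h (.inl b)).le)
  exact fun f hf => (hle hf).1

theorem unary_subset_of_downsets_eq {C C' : Set (KOp (ZMod 2) k)}
    (h : downsets C = downsets C') : unary C' ⊆ unary C := by
  intro u hu
  by_contra hcon
  exact of_constLower_eq (congrFun h (.inr (.inr u))) hcon hu

end Embedding

theorem clone_subset_of_data_eq {m : ℕ} {C C' : Set (KOp (ZMod 2) (m + 1))} (hC : IsClone C)
    (hC' : IsClone C') (h : downsets C = downsets C')
    (hconst : ∀ s c, constPart C' s c ∪ projSet m ⊆ constPart C s c ∪ projSet m)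
    (hflag : ∀ s c, (constPart C' s c ∩ projSet m).Nonempty →
      (constPart C s c ∩ projSet m).Nonempty) : C' ⊆ C :=
  clone_le_of_idempotent hC hC' (unary_subset_of_downsets_eq h)
    (idemPart_subset_of_downsets_eq hC h) fun _ _ hf s c hfs =>
      mem_of_constPart_subset
        (constPart_subset hC (Set.subset_union_left.trans (hconst s c)) (hflag s c)) hf hfs

open Classical in
/-- The clone and the flag attached to a sort and a value. -/
noncomputable def constData {m : ℕ} (C : cloneLattice (ZMod 2) (m + 1)) (s : Fin (m + 1))
    (c : ZMod 2) : ((cloneLattice (ZMod 2) m ∪ {∅} : Set (Set (KOp (ZMod 2) m)))) × Fin 2 :=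
  (⟨constPart C.1 s c ∪ projSet m, Or.inl ((mem_cloneLattice_iff _).2
    (isClone_constPart_union ((mem_cloneLattice_iff _).1 C.2) s c))⟩,
    if (constPart C.1 s c ∩ projSet m).Nonempty then 1 else 0)

theorem constData_mono {m : ℕ} {C C' : cloneLattice (ZMod 2) (m + 1)} (h : C ≤ C')
    (s : Fin (m + 1)) (c : ZMod 2) : constData C s c ≤ constData C' s c := by
  have hsub := constPart_mono (show C.1 ⊆ C'.1 from h) s c
  refine ⟨Set.union_subset_union_left _ hsub, ?_⟩
  simp only [constData]
  split_ifs with h1 h2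
  · exact le_rfl
  · exact (h2 (h1.mono (Set.inter_subset_inter_left _ hsub))).elim
  · exact Fin.zero_le _
  · exact le_rfl

theorem constData_eq {m : ℕ} {C C' : cloneLattice (ZMod 2) (m + 1)} {s : Fin (m + 1)} {c : ZMod 2}
    (h : constData C s c = constData C' s c) :
    constPart C.1 s c ∪ projSet m = constPart C'.1 s c ∪ projSet m ∧
      ((constPart C.1 s c ∩ projSet m).Nonempty ↔ (constPart C'.1 s c ∩ projSet m).Nonempty) := by
  refine ⟨congrArg (fun p => p.1.1) h, ?_⟩
  have h2 := congrArg Prod.snd h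
  simp only [constData] at h2
  split_ifs at h2 with h3 h4 h4
  · exact iff_of_true h3 h4
  · simp at h2
  · simp at h2
  · exact iff_of_false h3 h4

theorem posetEmbeds_cloneLattice (m : ℕ) (hm : 2 ≤ m + 1) :
    PosetEmbeds (cloneLattice (ZMod 2) (m + 1))
      ((Set (CR16 (m + 1)))ᵒᵈ × (LowerSet (Fin (2 * (m + 1)) → ℕ))ᵒᵈ ×
        (Fin (2 * (m + 1)) →
          ((cloneLattice (ZMod 2) m ∪ {∅} : Set (Set (KOp (ZMod 2) m))) × Fin 2))) := by
  let e : Fin 2 × Fin (m + 1) ≃ Fin (2 * (m + 1)) := finProdFinEquiv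
  refine ⟨fun C => (OrderDual.toDual {ρ | Invariant C.1 ρ.1},
    OrderDual.toDual (pack hm (downsets C.1)),
    fun j => constData C (e.symm j).2 (if (e.symm j).1 = 0 then 0 else 1)), ?_, ?_⟩
  · intro C C' h
    simp only [Prod.mk.injEq] at h
    obtain ⟨-, h2, h3⟩ := h
    have hdown : downsets C.1 = downsets C'.1 := pack_injective hm h2
    have hdata : ∀ s c, constData C s c = constData C' s c := by
      intro s c
      rcases zmod2_cases c with rfl | rfl
      · simpa using congrFun h3 (e (0, s))
      · simpa using congrFun h3 (e (1, s))
    have hC := (mem_cloneLattice_iff _).1 C.2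
    have hC' := (mem_cloneLattice_iff _).1 C'.2
    apply Subtype.ext
    apply Set.Subset.antisymm
    · exact clone_subset_of_data_eq hC' hC hdown.symm (fun s c => (constData_eq (hdata s c)).1.le)
        (fun s c => (constData_eq (hdata s c)).2.1)
    · exact clone_subset_of_data_eq hC hC' hdown (fun s c => (constData_eq (hdata s c)).1.ge)
        (fun s c => (constData_eq (hdata s c)).2.2)
  · intro C C' h
    refine ⟨?_, ?_, fun j => constData_mono h _ _⟩
    · exact fun ρ hρ n f hf => hρ n f (h hf)
    · exact pack_mono hm (downsets_antitone h)

end MultiSorted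

theorem mainTheorem7 (k : ℕ) (hk : 2 ≤ k) :
    MultiSorted.PosetEmbeds
      (MultiSorted.cloneLattice (ZMod 2) k)
      ((Set (MultiSorted.CR16 k))ᵒᵈ × (LowerSet (Fin (2 * k) → ℕ))ᵒᵈ ×
        (Fin (2 * k) →
          ((MultiSorted.cloneLattice (ZMod 2) (k - 1) ∪ {∅} :
            Set (Set (MultiSorted.KOp (ZMod 2) (k - 1)))) × Fin 2))) := by
  obtain ⟨m, rfl⟩ : ∃ m, k = m + 1 := ⟨k - 1, by omega⟩
  exact MultiSorted.posetEmbeds_cloneLattice m hk
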